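/- For $\alpha\in(1,2)$, integers $k\ge 3$ and $r\ge 1$, and real $x\ge 1$, let $L_{\alpha,k,r}(x)$ be the minimum of all real $y\ge 0$ such that there is an integer $n\in[x,x+y]$ for which the sequence $\bigl(\lfloor (n+rj)^\alpha\rfloor\bigr)_{j=0}^{k-1}$ is an arithmetic progression of length $k$ (a strictly increasing sequence of positive integers with constant consecutive differences). Let $\alpha\in(1,2)$, let $r\ge 1$ be an integer, and let $w:[1,\infty)\to(0,\infty)$ be an arbitrary function such that $x^{\alpha/2-1}w(x)\to 0$ and $w(x)\to\infty$ as $x\to\infty$. Then the minimum defining $L_{\alpha,3,r}(x)$ exists for every real $x\ge 1$, and \[ \lim_{M\to\infty}\frac{\#\{N\in\mathbb{Z} : 1\le N\le M,\ L_{\alpha,3,r}(N)\le N^{1-\alpha/2}w(N)\}}{M}=1 . \] -/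

import Mathlib

/-- `a 0, …, a (k - 1)` is a strictly increasing sequence of positive integers whose `d`-th order
differences `Δ₁^d a 0, …, Δ₁^d a (k - d - 1)` form a constant sequence. Only the first `k` terms
of `a` matter. For `d = 1` these are the arithmetic progressions of length `k`. -/
def IsPolySeq (k d : ℕ) (a : ℕ → ℤ) : Prop :=
  (∀ n < k, 0 < a n) ∧ StrictMonoOn a (Set.Iio k) ∧
    ∃ c : ℤ, ∀ n : ℕ, n + d < k → (fwdDiff 1)^[d] a n = c

/-- The set of all reals `y ≥ 0` such that some integer `n ∈ [x, x + y]` makes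
`(⌊(n + r j)^α⌋)_{j = 0}^{k - 1}` an arithmetic progression of length `k`. -/
def apLengthSet (α : ℝ) (k r : ℕ) (x : ℝ) : Set ℝ :=
  {y : ℝ | 0 ≤ y ∧ ∃ n : ℤ, (n : ℝ) ∈ Set.Icc x (x + y) ∧
    IsPolySeq k 1 (fun j : ℕ => ⌊((n : ℝ) + (r : ℝ) * (j : ℝ)) ^ α⌋)}

/-- The minimum length `L_{α,k,r}(x) = min (apLengthSet α k r x)`. -/
noncomputable def minLength (α : ℝ) (k r : ℕ) (x : ℝ) : ℝ :=
  sInf (apLengthSet α k r x)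

/-! Near a large `N` the function is almost linear: `(N + h) ^ α ≈ N ^ α + h θ` with `θ = α N ^ (α -
1)`, for bounded `h`, since the second derivative tends to zero. Three terms with common difference
`ρ = r θ` have floors in progression once the middle one is near a half-integer and `2 ρ` is not
near an integer (`floor_sub_floor_eq_of_close`). A bounded shift `m` achieves the former unless some
`q θ` with small `q` is near an integer (`exists_nat_abs_mul_sub_int_le`). The excluded `N` have
small upper density because `c N ^ s`, `0 < s < 1`, is rarely near an integer. So off a set of
density `ε` the gap is at most a constant `K`, eventually below `w N`. -/

/-- The tangent line inequality for the convex function `x ↦ x ^ α`. -/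
theorem rpow_add_mul_le_rpow {α a b : ℝ} (hα : 1 ≤ α) (ha : 0 < a) (hb : 0 ≤ b) :
    a ^ α + α * a ^ (α - 1) * (b - a) ≤ b ^ α := by
  have h1 : -1 ≤ (b - a) / a := by
    rw [le_div_iff₀ ha]; linarith
  have h2 := one_add_mul_self_le_rpow_one_add h1 hα
  have h3 : 1 + (b - a) / a = b / a := by field_simp; ring
  rw [h3, Real.div_rpow hb ha.le, le_div_iff₀ (Real.rpow_pos_of_pos ha α)] at h2
  have h4 : a ^ α = a ^ (α - 1) * a := by
    rw [← Real.rpow_add_one ha.ne']; congr 1; ring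
  calc a ^ α + α * a ^ (α - 1) * (b - a) = (1 + α * ((b - a) / a)) * a ^ α := by
        rw [h4]; field_simp
    _ ≤ b ^ α := h2

-- The tangents at `N` and at `N + h` squeeze the error between `0` and `h α ((N + h) ^ (α - 1) - N
-- ^ (α - 1))`, which is `O(N ^ (α - 2))` by concavity of `t ^ (α - 1)`.
open Filter Topology in
theorem tendsto_rpow_add_sub_tangent {α : ℝ} (hα : α ∈ Set.Ioo (1 : ℝ) 2) (h : ℕ) :
    Tendsto (fun N : ℕ => ((N : ℝ) + h) ^ α - (N : ℝ) ^ α - h * (α * (N : ℝ) ^ (α - 1)))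
      atTop (𝓝 0) := by
  obtain ⟨h1, h2⟩ := hα
  have hlim : Tendsto (fun N : ℕ => (h * α * ((α - 1) * h)) * (N : ℝ) ^ (-(2 - α))) atTop (𝓝 0) := by
    have := ((tendsto_rpow_neg_atTop (show 0 < 2 - α by linarith)).comp
      tendsto_natCast_atTop_atTop).const_mul ((h : ℝ) * α * ((α - 1) * h))
    simpa using this
  refine tendsto_of_tendsto_of_tendsto_of_le_of_le' tendsto_const_nhds hlim ?_ ?_
  · filter_upwards [eventually_gt_atTop 0] with N hN
    have hN' : (0 : ℝ) < N := by exact_mod_cast hN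
    have := rpow_add_mul_le_rpow h1.le hN' (show (0 : ℝ) ≤ N + h by positivity)
    nlinarith
  · filter_upwards [eventually_gt_atTop 0] with N hN
    have hN' : (0 : ℝ) < N := by exact_mod_cast hN
    have hNh : (0 : ℝ) < N + h := by positivity
    have e1 := rpow_add_mul_le_rpow h1.le hNh hN'.le
    have e2 : ((N : ℝ) + h) ^ (α - 1) ≤ (N : ℝ) ^ (α - 1) + (α - 1) * h * (N : ℝ) ^ (-(2 - α)) := by
      have h3 : (N : ℝ) + h = N * (1 + h / N) := by field_simp
      have h4 : (0 : ℝ) ≤ h / N := by positivity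
      have h5 := rpow_one_add_le_one_add_mul_self (show -1 ≤ (h : ℝ) / N by linarith)
        (show 0 ≤ α - 1 by linarith) (show α - 1 ≤ 1 by linarith)
      have h6 : (N : ℝ) ^ (α - 1) = (N : ℝ) ^ (-(2 - α)) * N := by
        rw [← Real.rpow_add_one hN'.ne']; congr 1; ring
      rw [h3, Real.mul_rpow hN'.le (by positivity)]
      calc (N : ℝ) ^ (α - 1) * (1 + (h : ℝ) / N) ^ (α - 1)
          ≤ (N : ℝ) ^ (α - 1) * (1 + (α - 1) * (h / N)) := by gcongr
        _ = (N : ℝ) ^ (α - 1) + (α - 1) * h * (N : ℝ) ^ (-(2 - α)) := by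
          rw [h6]; field_simp
    have e3 : (h : ℝ) * α * ((N : ℝ) + h) ^ (α - 1) ≤
        h * α * ((N : ℝ) ^ (α - 1) + (α - 1) * h * (N : ℝ) ^ (-(2 - α))) := by
      gcongr
    nlinarith

/-! ### Values of `c N ^ s` near integers -/

/-- Convexity of `t ^ s⁻¹` compares the window around `j` with the gap that follows it, so that the
bound telescopes in `j`. -/
theorem card_filter_abs_mul_rpow_sub_lt_le {c s η : ℝ} (hc : 0 < c) (hs : s ∈ Set.Ioo (0 : ℝ) 1)
    (hη : 0 < η) (M j : ℕ) :
    (((Finset.Icc 1 M).filter fun N : ℕ => |c * (N : ℝ) ^ s - j| < η).card : ℝ) ≤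
      2 * η * ((((j + 1 : ℕ) + η) / c) ^ s⁻¹ - ((j + η) / c) ^ s⁻¹) + 1 := by
  obtain ⟨hs0, hs1⟩ := hs
  have hp : 1 ≤ s⁻¹ := (one_le_inv₀ hs0).2 hs1.le
  set x : ℝ := max (j - η) 0 / c with hx
  set y : ℝ := (j + η) / c with hy
  set z : ℝ := ((j + 1 : ℕ) + η) / c with hz
  have hx0 : 0 ≤ x := by positivity
  have hxy : x < y := by
    rw [hx, hy]; gcongr
    exact max_lt (by linarith) (by positivity)
  have hyz : y < z := by
    rw [hy, hz]; push_cast; gcongr; linarith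
  have hconv := (convexOn_rpow hp).slope_mono_adjacent (Set.mem_Ici.2 hx0)
    (Set.mem_Ici.2 (hx0.trans (hxy.trans hyz).le)) hxy hyz
  have hzy : z - y = 1 / c := by rw [hy, hz]; push_cast; ring
  have hyx : y - x ≤ 2 * η / c := by
    rw [hy, hx, ← sub_div]; gcongr
    linarith [le_max_left ((j : ℝ) - η) 0]
  have hmono : 0 ≤ z ^ s⁻¹ - y ^ s⁻¹ :=
    sub_nonneg.2 (Real.rpow_le_rpow (hx0.trans hxy.le) hyz.le (by positivity))
  have hgap : y ^ s⁻¹ - x ^ s⁻¹ ≤ 2 * η * (z ^ s⁻¹ - y ^ s⁻¹) := by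
    rw [div_le_iff₀ (by linarith), hzy] at hconv
    calc y ^ s⁻¹ - x ^ s⁻¹ ≤ (z ^ s⁻¹ - y ^ s⁻¹) / (1 / c) * (y - x) := hconv
      _ ≤ (z ^ s⁻¹ - y ^ s⁻¹) / (1 / c) * (2 * η / c) := by gcongr
      _ = _ := by field_simp
  have hsub : ((Finset.Icc 1 M).filter fun N : ℕ => |c * (N : ℝ) ^ s - j| < η) ⊆
      Finset.Icc ⌈x ^ s⁻¹⌉₊ ⌊y ^ s⁻¹⌋₊ := by
    intro N hN
    obtain ⟨-, hN⟩ := Finset.mem_filter.1 hN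
    rw [abs_lt] at hN
    have hN0 : (0 : ℝ) ≤ N := Nat.cast_nonneg N
    have hcN : 0 ≤ c * (N : ℝ) ^ s := by positivity
    have hback : ((N : ℝ) ^ s) ^ s⁻¹ = N := Real.rpow_rpow_inv hN0 hs0.ne'
    rw [Finset.mem_Icc, Nat.ceil_le, Nat.le_floor_iff (Real.rpow_nonneg (hx0.trans hxy.le) _)]
    constructor
    · rw [← hback]
      refine Real.rpow_le_rpow hx0 ?_ (by positivity)
      rw [hx, div_le_iff₀ hc]
      exact max_le (by linarith) (by linarith)
    · rw [← hback]
      refine Real.rpow_le_rpow (by positivity) ?_ (by positivity)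
      rw [hy, le_div_iff₀ hc]
      linarith
  have hcard := Finset.card_le_card hsub
  rw [Nat.card_Icc] at hcard
  have hle : ⌈x ^ s⁻¹⌉₊ ≤ ⌊y ^ s⁻¹⌋₊ + 1 := by
    refine (Nat.ceil_mono (Real.rpow_le_rpow hx0 hxy.le (by positivity))).trans ?_
    exact Nat.ceil_le_floor_add_one _
  have hcard' : (((Finset.Icc 1 M).filter fun N : ℕ => |c * (N : ℝ) ^ s - j| < η).card : ℝ) ≤
      (⌊y ^ s⁻¹⌋₊ : ℝ) + 1 - ⌈x ^ s⁻¹⌉₊ := by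
    rw [← Nat.cast_add_one, ← Nat.cast_sub hle]
    exact_mod_cast hcard
  have := Nat.floor_le (Real.rpow_nonneg (hx0.trans hxy.le) s⁻¹)
  have := Nat.le_ceil (x ^ s⁻¹)
  linarith

open Filter in
/-- The proportion of `N ≤ M` for which `c N ^ s` is within `η` of an integer is `O(η)`. -/
theorem eventually_card_filter_abs_sub_round_le {c s η : ℝ} (hc : 0 < c)
    (hs : s ∈ Set.Ioo (0 : ℝ) 1) (hη : 0 < η) (hη1 : η ≤ 1) :
    ∀ᶠ M : ℕ in atTop, (((Finset.Icc 1 M).filter fun N : ℕ =>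
      |c * (N : ℝ) ^ s - round (c * (N : ℝ) ^ s)| < η).card : ℝ) ≤ 5 * η * M := by
  have hs' := hs
  obtain ⟨hs0, hs1⟩ := hs'
  have hpow : Tendsto (fun M : ℕ => (M : ℝ) ^ s) atTop atTop :=
    (tendsto_rpow_atTop hs0).comp tendsto_natCast_atTop_atTop
  have h2s : 0 < (2 : ℝ) ^ s - 1 := sub_pos.2 (Real.one_lt_rpow (by norm_num) hs0)
  have hpow' : Tendsto (fun M : ℕ => (M : ℝ) ^ (1 - s)) atTop atTop :=
    (tendsto_rpow_atTop (sub_pos.2 hs1)).comp tendsto_natCast_atTop_atTop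
  -- The telescoped sum is at most `2 M` and the `J + 1` extra units at most `η M`: in total `2 η *
  -- 2 M + η M`.
  filter_upwards [hpow.eventually_ge_atTop (3 / c / ((2 : ℝ) ^ s - 1)),
    hpow.eventually_ge_atTop 1, hpow'.eventually_ge_atTop ((c + 2) / η),
    eventually_gt_atTop 0] with M hM1 hM3 hM2 hM0
  have hMpos : (0 : ℝ) < M := by exact_mod_cast hM0
  set J : ℕ := ⌊c * (M : ℝ) ^ s + 1⌋₊ with hJ
  have hJle : (J : ℝ) ≤ c * (M : ℝ) ^ s + 1 := Nat.floor_le (by positivity)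
  have hsub : ((Finset.Icc 1 M).filter fun N : ℕ =>
      |c * (N : ℝ) ^ s - round (c * (N : ℝ) ^ s)| < η) ⊆
      (Finset.range (J + 1)).biUnion fun j =>
        (Finset.Icc 1 M).filter fun N : ℕ => |c * (N : ℝ) ^ s - j| < η := by
    intro N hN
    obtain ⟨hNM, hN⟩ := Finset.mem_filter.1 hN
    have hround : 0 ≤ round (c * (N : ℝ) ^ s) := by
      rw [round_eq]; positivity
    obtain ⟨j, hj⟩ := Int.eq_ofNat_of_zero_le hround
    rw [hj, Int.cast_natCast] at hN
    refine Finset.mem_biUnion.2 ⟨j, ?_, Finset.mem_filter.2 ⟨hNM, hN⟩⟩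
    rw [Finset.mem_range, Nat.lt_succ_iff, hJ, Nat.le_floor_iff (by positivity)]
    have hNM' : (N : ℝ) ≤ M := by exact_mod_cast (Finset.mem_Icc.1 hNM).2
    have : c * (N : ℝ) ^ s ≤ c * (M : ℝ) ^ s := by gcongr
    linarith [(abs_lt.1 hN).1]
  have hsum : (((Finset.Icc 1 M).filter fun N : ℕ =>
      |c * (N : ℝ) ^ s - round (c * (N : ℝ) ^ s)| < η).card : ℝ) ≤
      ∑ j ∈ Finset.range (J + 1),
        (2 * η * ((((j + 1 : ℕ) + η) / c) ^ s⁻¹ - ((j + η) / c) ^ s⁻¹) + 1) := by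
    calc _ ≤ ((∑ j ∈ Finset.range (J + 1),
          ((Finset.Icc 1 M).filter fun N : ℕ => |c * (N : ℝ) ^ s - j| < η).card : ℕ) : ℝ) := by
          exact_mod_cast (Finset.card_le_card hsub).trans Finset.card_biUnion_le
      _ ≤ _ := by
          rw [Nat.cast_sum]
          exact Finset.sum_le_sum fun j _ => card_filter_abs_mul_rpow_sub_lt_le hc hs hη M j
  rw [Finset.sum_add_distrib, ← Finset.mul_sum,
    Finset.sum_range_sub (fun j : ℕ => (((j : ℝ) + η) / c) ^ s⁻¹)] at hsum
  have hG : ((((J + 1 : ℕ) : ℝ) + η) / c) ^ s⁻¹ ≤ 2 * M := by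
    rw [div_le_iff₀ h2s] at hM1
    have hMM : (2 * (M : ℝ)) = ((2 * (M : ℝ)) ^ s) ^ s⁻¹ :=
      (Real.rpow_rpow_inv (by positivity) hs0.ne').symm
    rw [hMM]
    refine Real.rpow_le_rpow (by positivity) ?_ (by positivity)
    rw [Real.mul_rpow (by norm_num) hMpos.le]
    calc (((J + 1 : ℕ) : ℝ) + η) / c ≤ (c * (M : ℝ) ^ s + 3) / c := by
          refine div_le_div_of_nonneg_right ?_ hc.le; push_cast; linarith
      _ = (M : ℝ) ^ s + 3 / c := by field_simp
      _ ≤ _ := by linarith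
  have hlin : (J : ℝ) + 1 ≤ η * M := by
    rw [div_le_iff₀ hη] at hM2
    have hsplit : (M : ℝ) ^ (1 - s) * (M : ℝ) ^ s = M := by
      rw [← Real.rpow_add hMpos]; simp
    calc (J : ℝ) + 1 ≤ (c + 2) * (M : ℝ) ^ s := by linarith
      _ ≤ (M : ℝ) ^ (1 - s) * η * (M : ℝ) ^ s := by gcongr
      _ = η * ((M : ℝ) ^ (1 - s) * (M : ℝ) ^ s) := by ring
      _ = η * M := by rw [hsplit]
  have h0 : 0 ≤ (((((0 : ℕ) : ℝ)) + η) / c) ^ s⁻¹ := by positivity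
  simp only [Finset.sum_const, Finset.card_range, nsmul_eq_mul, mul_one] at hsum
  push_cast at hsum hG h0
  nlinarith

/-! ### Shifts modulo one and progressions of floors -/

/-- If no positive integer `q ≤ Q` brings `q θ` within `δ` of an integer, then the multiples
`m θ` with `m ≤ Q ⌈1 / δ⌉` are `1 / (Q + 1)`-dense modulo one. -/
theorem exists_nat_abs_mul_sub_int_le {θ δ : ℝ} {Q : ℕ} (hQ : 0 < Q) (hδ : 0 < δ)
    (hθ : ∀ q : ℕ, 0 < q → q ≤ Q → δ ≤ |q * θ - round (q * θ)|) (y : ℝ) :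
    ∃ m : ℕ, m ≤ Q * ⌈1 / δ⌉₊ ∧ ∃ k : ℤ, |m * θ - y - k| ≤ 1 / (Q + 1) := by
  -- Dirichlet gives a step `q θ - j` of size between `δ` and `1 / (Q + 1)`; at most `⌈1 / δ⌉` such
  -- steps reach any target modulo one, up to one step.
  obtain ⟨j, q, hq0, hqQ, hq⟩ := Real.exists_int_int_abs_mul_sub_le θ hQ
  lift q to ℕ using hq0.le
  rw [Int.cast_natCast] at hq
  have hq0' : 0 < q := by exact_mod_cast hq0
  have hqQ' : q ≤ Q := by exact_mod_cast hqQ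
  have hlow : δ ≤ |q * θ - j| := (hθ q hq0' hqQ').trans (round_le _ _)
  have key : ∀ (τ z : ℝ), δ ≤ τ → τ ≤ 1 / (Q + 1) →
      ∃ i : ℕ, i ≤ ⌈1 / δ⌉₊ ∧ |i * τ - Int.fract z| ≤ 1 / (Q + 1) := by
    intro τ z h1 h2
    have hτ : 0 < τ := hδ.trans_le h1
    have hz := Int.fract_nonneg z
    refine ⟨⌊Int.fract z / τ⌋₊, ?_, ?_⟩
    · refine (Nat.floor_mono ?_).trans (Nat.floor_le_ceil (1 / δ))
      exact div_le_div₀ zero_le_one (Int.fract_lt_one z).le hδ h1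
    · have ha := Nat.floor_le (show 0 ≤ Int.fract z / τ by positivity)
      have hb := Nat.lt_floor_add_one (Int.fract z / τ)
      rw [le_div_iff₀ hτ] at ha
      rw [div_lt_iff₀ hτ] at hb
      rw [abs_le]
      constructor <;> nlinarith
  rcases le_total 0 ((q : ℝ) * θ - j) with hsgn | hsgn
  · rw [abs_of_nonneg hsgn] at hq hlow
    obtain ⟨i, hi, hi'⟩ := key _ y hlow hq
    refine ⟨q * i, Nat.mul_le_mul hqQ' hi, i * j - ⌊y⌋, ?_⟩
    convert hi' using 2
    rw [Int.fract]; push_cast; ring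
  · rw [abs_of_nonpos hsgn] at hq hlow
    obtain ⟨i, hi, hi'⟩ := key _ (-y) hlow hq
    refine ⟨q * i, Nat.mul_le_mul hqQ' hi, i * j + ⌊-y⌋, ?_⟩
    rw [← abs_neg]
    convert hi' using 2
    rw [Int.fract]; push_cast; ring

theorem isPolySeq_three_one_floor_rpow {α : ℝ} (hα : 1 < α) {r : ℕ} (hr : 1 ≤ r) {n : ℤ}
    (hn : 1 ≤ n)
    (h : ⌊((n : ℝ) + 2 * r) ^ α⌋ - ⌊((n : ℝ) + r) ^ α⌋ = ⌊((n : ℝ) + r) ^ α⌋ - ⌊(n : ℝ) ^ α⌋) :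
    IsPolySeq 3 1 (fun j : ℕ => ⌊((n : ℝ) + (r : ℝ) * (j : ℝ)) ^ α⌋) := by
  have hn' : (1 : ℝ) ≤ n := by exact_mod_cast hn
  have hr' : (1 : ℝ) ≤ r := by exact_mod_cast hr
  have hmono : StrictMono (fun j : ℕ => ⌊((n : ℝ) + (r : ℝ) * (j : ℝ)) ^ α⌋) := by
    refine strictMono_nat_of_lt_succ fun j => ?_
    have ha : (1 : ℝ) ≤ n + r * j := by nlinarith [(Nat.cast_nonneg j : (0 : ℝ) ≤ j)]
    have h1 := rpow_add_mul_le_rpow hα.le (show (0 : ℝ) < n + r * j by linarith)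
      (show (0 : ℝ) ≤ n + r * (j + 1 : ℕ) by positivity)
    have h2 : 1 ≤ ((n : ℝ) + r * j) ^ (α - 1) := Real.one_le_rpow ha (by linarith)
    have h3 : 1 ≤ α * ((n : ℝ) + r * j) ^ (α - 1) * (n + r * (j + 1 : ℕ) - (n + r * j)) := by
      have e : (n : ℝ) + r * (j + 1 : ℕ) - (n + r * j) = r := by push_cast; ring
      rw [e]
      exact one_le_mul_of_one_le_of_one_le (one_le_mul_of_one_le_of_one_le hα.le h2) hr'
    have h4 : ((n : ℝ) + r * j) ^ α + 1 ≤ ((n : ℝ) + r * (j + 1 : ℕ)) ^ α := by linarith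
    have h5 := Int.floor_mono h4
    rw [Int.floor_add_one] at h5
    exact Int.add_one_le_iff.1 h5
  refine ⟨fun j _ => ?_, hmono.strictMonoOn _,
    ⌊((n : ℝ) + r) ^ α⌋ - ⌊(n : ℝ) ^ α⌋, fun j hj => ?_⟩
  · refine lt_of_lt_of_le ?_ (hmono.monotone (Nat.zero_le j))
    refine Int.lt_iff_add_one_le.2 (Int.le_floor.2 ?_)
    simpa using Real.one_le_rpow hn' (by linarith)
  · have hj' : j = 0 ∨ j = 1 := by omega
    rcases hj' with rfl | rfl
    · simp [fwdDiff]
    · rw [← h]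
      simp [fwdDiff, mul_comm]

/-- If three consecutive terms are close to an arithmetic progression whose middle term is near a
half-integer and whose common difference `ρ` has `2 ρ` away from the integers, then their integer
parts form an arithmetic progression. -/
theorem floor_sub_floor_eq_of_close {η ρ u a b c : ℝ} {k : ℤ}
    (hρ : η ≤ |2 * ρ - round (2 * ρ)|)
    (hu : |u + (ρ - round ρ) - 1 / 2 - k| ≤ η / 8)
    (ha : |a - u| ≤ η / 8) (hb : |b - (u + ρ)| ≤ η / 8) (hc : |c - (u + 2 * ρ)| ≤ η / 8) (hη : 0 < η) :
    ⌊c⌋ - ⌊b⌋ = ⌊b⌋ - ⌊a⌋ := by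
  have hβ := abs_le.1 (abs_sub_round ρ)
  -- Only the odd integers next to `2 ρ` matter: they force `|ρ - round ρ| ≤ (1 - η) / 2`. The outer
  -- terms then stay `η / 2` from integers, more than the total error `η / 4`.
  have h1 : η ≤ |2 * ρ - (2 * round ρ + 1 : ℤ)| := hρ.trans (round_le _ _)
  have h2 : η ≤ |2 * ρ - (2 * round ρ - 1 : ℤ)| := hρ.trans (round_le _ _)
  push_cast at h1 h2
  rw [abs_of_nonpos (by linarith)] at h1
  rw [abs_of_nonneg (by linarith)] at h2
  rw [abs_le] at hu ha hb hc
  have fa : ⌊a⌋ = k := by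
    rw [Int.floor_eq_iff]; constructor <;> linarith
  have fb : ⌊b⌋ = k + round ρ := by
    rw [Int.floor_eq_iff]; push_cast; constructor <;> linarith
  have fc : ⌊c⌋ = k + 2 * round ρ := by
    rw [Int.floor_eq_iff]; push_cast; constructor <;> linarith
  rw [fa, fb, fc]; ring

/-! ### Bounded gaps off a sparse set -/

open Filter in
/-- For all `N` outside a set of upper density at most `ε` an arithmetic progression starts within
a bounded distance of `N`. -/
theorem exists_eventually_card_filter_not_isPolySeq_le {α : ℝ} (hα : α ∈ Set.Ioo (1 : ℝ) 2) {r : ℕ}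
    (hr : 1 ≤ r) {ε : ℝ} (hε : 0 < ε) :
    ∃ (K : ℕ) (B : ℕ → Prop), (∀ᶠ N : ℕ in atTop, ¬ B N → ∃ m : ℕ, m ≤ K ∧
        IsPolySeq 3 1 (fun j : ℕ => ⌊(((N + m : ℕ) : ℤ) + (r : ℝ) * (j : ℝ)) ^ α⌋)) ∧
      ∀ᶠ M : ℕ in atTop, (Set.ncard {N : ℕ | N ∈ Set.Icc 1 M ∧ B N} : ℝ) ≤ ε * M := by
  classical
  obtain ⟨h1, h2⟩ := hα
  have hs : α - 1 ∈ Set.Ioo (0 : ℝ) 1 := ⟨by linarith, by linarith⟩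
  -- `Q` makes the density error at most `η / 8`; the two kinds of bad `N` cost `5 η ≤ ε / 2` and `5
  -- δ Q ≤ ε / 2`.
  set η : ℝ := min 1 (ε / 10) with hηdef
  have hη : 0 < η := by positivity
  set Q : ℕ := ⌈8 / η⌉₊ with hQdef
  have hQ : 0 < Q := Nat.ceil_pos.2 (by positivity)
  have hQ' : (0 : ℝ) < Q := by exact_mod_cast hQ
  set δ : ℝ := min 1 (ε / (10 * Q)) with hδdef
  have hδ : 0 < δ := by positivity
  have hQη : 1 / ((Q : ℝ) + 1) ≤ η / 8 := by
    have : 8 / η ≤ Q := Nat.le_ceil _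
    rw [div_le_iff₀ hη] at this
    rw [div_le_iff₀ (by positivity)]
    nlinarith
  set K : ℕ := Q * ⌈1 / δ⌉₊ with hK
  set A : ℕ → ℝ → ℕ → Prop := fun q t N =>
    |q * α * (N : ℝ) ^ (α - 1) - round (q * α * (N : ℝ) ^ (α - 1))| < t with hA
  refine ⟨K, fun N => A (2 * r) η N ∨ ∃ q ∈ Finset.Icc 1 Q, A q δ N, ?_, ?_⟩
  · have htay : ∀ᶠ N : ℕ in atTop, ∀ h ∈ Finset.range (K + 2 * r + 1),
        |((N : ℝ) + h) ^ α - (N : ℝ) ^ α - h * (α * (N : ℝ) ^ (α - 1))| ≤ η / 8 := by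
      rw [Filter.eventually_all_finset]
      intro h _
      have := (tendsto_rpow_add_sub_tangent ⟨h1, h2⟩ h).abs
      rw [abs_zero] at this
      exact this.eventually_le_const (by positivity)
    filter_upwards [htay, eventually_ge_atTop 1] with N hN hN1 hgood
    push Not at hgood
    obtain ⟨hg1, hg2⟩ := hgood
    set θ : ℝ := α * (N : ℝ) ^ (α - 1) with hθ
    obtain ⟨m, hm, k, hk⟩ := exists_nat_abs_mul_sub_int_le (θ := θ) hQ hδ
      (fun q hq hqQ => by
        have := hg2 q (Finset.mem_Icc.2 ⟨hq, hqQ⟩)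
        simpa [hA, mul_assoc, hθ] using this)
      -- This target puts the middle term `N ^ α + (m + r) θ` near a half-integer.
      (1 / 2 - (r * θ - round (r * θ)) - (N : ℝ) ^ α)
    refine ⟨m, hm, isPolySeq_three_one_floor_rpow h1 hr (by omega) ?_⟩
    refine floor_sub_floor_eq_of_close (η := η) (ρ := r * θ) (u := (N : ℝ) ^ α + m * θ) (k := k)
      ?_ ?_ ?_ ?_ ?_ hη
    · simpa [hA, mul_assoc, hθ] using hg1
    · refine le_trans (le_of_eq ?_) (hk.trans hQη)
      congr 1; ring
    · refine le_trans (le_of_eq ?_) (hN m (Finset.mem_range.2 (by omega)))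
      push_cast; congr 1; ring
    · refine le_trans (le_of_eq ?_) (hN (m + r) (Finset.mem_range.2 (by omega)))
      push_cast; rw [← add_assoc]; congr 1; ring
    · refine le_trans (le_of_eq ?_) (hN (m + 2 * r) (Finset.mem_range.2 (by omega)))
      push_cast; rw [← add_assoc]; congr 1; ring
  · have hcount : ∀ q : ℕ, 1 ≤ q → ∀ t : ℝ, 0 < t → t ≤ 1 → ∀ᶠ M : ℕ in atTop,
        (((Finset.Icc 1 M).filter (A q t)).card : ℝ) ≤ 5 * t * M := by
      intro q hq t ht ht1
      have hq' : (0 : ℝ) < q := by exact_mod_cast hq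
      exact eventually_card_filter_abs_sub_round_le (mul_pos hq' (by linarith)) hs ht ht1
    have hall : ∀ᶠ M : ℕ in atTop, ∀ q ∈ Finset.Icc 1 Q,
        (((Finset.Icc 1 M).filter (A q δ)).card : ℝ) ≤ 5 * δ * M := by
      rw [Filter.eventually_all_finset]
      exact fun q hq => hcount q (Finset.mem_Icc.1 hq).1 δ hδ (min_le_left _ _)
    filter_upwards [hcount (2 * r) (by omega) η hη (min_le_left _ _), hall] with M hM1 hM2
    have hset : {N : ℕ | N ∈ Set.Icc 1 M ∧ (A (2 * r) η N ∨ ∃ q ∈ Finset.Icc 1 Q, A q δ N)} ⊆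
        (((Finset.Icc 1 M).filter (A (2 * r) η) ∪
          (Finset.Icc 1 Q).biUnion fun q => (Finset.Icc 1 M).filter (A q δ) : Finset ℕ) :
          Set ℕ) := by
      rintro N ⟨hN, hN'⟩
      rw [Finset.mem_coe, Finset.mem_union, Finset.mem_biUnion]
      rcases hN' with hN' | ⟨q, hq, hN'⟩
      · exact Or.inl (Finset.mem_filter.2 ⟨Finset.mem_Icc.2 hN, hN'⟩)
      · exact Or.inr ⟨q, hq, Finset.mem_filter.2 ⟨Finset.mem_Icc.2 hN, hN'⟩⟩
    have hcard := Set.ncard_le_ncard hset (Finset.finite_toSet _)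
    rw [Set.ncard_coe_finset] at hcard
    have hcard' : (Set.ncard {N : ℕ | N ∈ Set.Icc 1 M ∧
        (A (2 * r) η N ∨ ∃ q ∈ Finset.Icc 1 Q, A q δ N)} : ℝ) ≤
        ((Finset.Icc 1 M).filter (A (2 * r) η)).card +
          ∑ q ∈ Finset.Icc 1 Q, (((Finset.Icc 1 M).filter (A q δ)).card : ℝ) := by
      exact_mod_cast hcard.trans ((Finset.card_union_le _ _).trans
        (Nat.add_le_add_left Finset.card_biUnion_le _))
    have hsum := Finset.sum_le_sum hM2
    rw [Finset.sum_const, Nat.card_Icc, nsmul_eq_mul, Nat.add_sub_cancel] at hsum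
    have hηε : η ≤ ε / 10 := min_le_right _ _
    have hδε : δ * Q ≤ ε / 10 := by
      calc δ * Q ≤ ε / (10 * Q) * Q := by gcongr; exact min_le_right _ _
        _ = ε / 10 := by field_simp
    have hM0 : (0 : ℝ) ≤ M := Nat.cast_nonneg M
    calc _ ≤ 5 * η * M + Q * (5 * δ * M) := hcard'.trans (add_le_add hM1 hsum)
      _ = 5 * (η + δ * Q) * M := by ring
      _ ≤ ε * M := by gcongr; linarith

-- A bad set of density at most `1 / 2` cannot contain all of `(N₁, M]` once `M > 2 N₁`.
open Filter in
theorem exists_int_ge_isPolySeq {α : ℝ} (hα : α ∈ Set.Ioo (1 : ℝ) 2) {r : ℕ} (hr : 1 ≤ r)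
    (x : ℝ) : ∃ n : ℤ, x ≤ n ∧
      IsPolySeq 3 1 (fun j : ℕ => ⌊((n : ℝ) + (r : ℝ) * (j : ℝ)) ^ α⌋) := by
  obtain ⟨K, B, hgood, hcount⟩ :=
    exists_eventually_card_filter_not_isPolySeq_le hα hr (show (0 : ℝ) < 1 / 2 by norm_num)
  obtain ⟨N₀, hN₀⟩ := eventually_atTop.1 hgood
  set N₁ := max N₀ ⌈x⌉₊ with hN₁
  obtain ⟨M, hM, hMbig⟩ := (hcount.and (eventually_gt_atTop (2 * N₁))).exists
  have hex : ∃ N, N₁ ≤ N ∧ ¬ B N := by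
    by_contra! hcon
    have hsub : Set.Icc (N₁ + 1) M ⊆ {N : ℕ | N ∈ Set.Icc 1 M ∧ B N} := fun N hN =>
      ⟨⟨by have := hN.1; omega, hN.2⟩, hcon N (by have := hN.1; omega)⟩
    have hle := Set.ncard_le_ncard hsub ((Set.finite_Icc 1 M).subset fun N hN => hN.1)
    rw [← Finset.coe_Icc, Set.ncard_coe_finset, Nat.card_Icc] at hle
    have hle' : (M : ℝ) ≤ N₁ + Set.ncard {N : ℕ | N ∈ Set.Icc 1 M ∧ B N} := by
      exact_mod_cast (by omega)
    have hMbig' : (2 * N₁ : ℝ) < M := by exact_mod_cast hMbig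
    linarith
  obtain ⟨N, hN, hNB⟩ := hex
  obtain ⟨m, -, hm⟩ := hN₀ N ((le_max_left _ _).trans hN) hNB
  refine ⟨((N + m : ℕ) : ℤ), ?_, hm⟩
  have hx : x ≤ ⌈x⌉₊ := Nat.le_ceil x
  have hx' : ((⌈x⌉₊ : ℕ) : ℝ) ≤ (N + m : ℕ) := by
    exact_mod_cast ((le_max_right N₀ _).trans hN).trans (Nat.le_add_right N m)
  rw [Int.cast_natCast]
  linarith

/-! ### Attained minimum and density one -/

theorem isLeast_apLengthSet_minLength {α : ℝ} {k r : ℕ} {x : ℝ}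
    (h : ∃ n : ℤ, x ≤ n ∧ IsPolySeq k 1 (fun j : ℕ => ⌊((n : ℝ) + (r : ℝ) * (j : ℝ)) ^ α⌋)) :
    IsLeast (apLengthSet α k r x) (minLength α k r x) := by
  obtain ⟨n₀, ⟨hn₀, hAP⟩, hmin⟩ := Int.exists_least_of_bdd
    (P := fun n : ℤ => x ≤ n ∧ IsPolySeq k 1 (fun j : ℕ => ⌊((n : ℝ) + (r : ℝ) * (j : ℝ)) ^ α⌋))
    ⟨⌈x⌉, fun n hn => Int.ceil_le.2 hn.1⟩ h
  have hleast : IsLeast (apLengthSet α k r x) (n₀ - x) := by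
    refine ⟨⟨by linarith, n₀, ⟨hn₀, by linarith⟩, hAP⟩, ?_⟩
    rintro y ⟨-, n, ⟨hn1, hn2⟩, hn⟩
    have : (n₀ : ℝ) ≤ n := by exact_mod_cast hmin n ⟨hn1, hn⟩
    linarith
  rw [minLength, hleast.csInf_eq]
  exact hleast

open Filter in
theorem tendsto_ncard_div_of_forall_eventually {P : ℕ → Prop}
    (h : ∀ ε : ℝ, 0 < ε → ∃ B : ℕ → Prop, (∀ᶠ N : ℕ in atTop, ¬ B N → P N) ∧
      ∀ᶠ M : ℕ in atTop, (Set.ncard {N : ℕ | N ∈ Set.Icc 1 M ∧ B N} : ℝ) ≤ ε * M) :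
    Tendsto (fun M : ℕ => (Set.ncard {N : ℕ | N ∈ Set.Icc 1 M ∧ P N} : ℝ) / M)
      atTop (nhds 1) := by
  rw [Metric.tendsto_atTop']
  intro ε hε
  obtain ⟨B, hBP, hB⟩ := h (ε / 4) (by positivity)
  obtain ⟨N₀, hN₀⟩ := eventually_atTop.1 hBP
  obtain ⟨M₀, hM₀⟩ := eventually_atTop.1 (hB.and ((eventually_gt_atTop 0).and
    (tendsto_natCast_atTop_atTop.eventually_ge_atTop (N₀ / (ε / 4)))))
  refine ⟨M₀, fun M hM => ?_⟩
  obtain ⟨hBM, hM0, hMN⟩ := hM₀ M hM.le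
  have hMpos : (0 : ℝ) < M := by exact_mod_cast hM0
  rw [div_le_iff₀ (by positivity)] at hMN
  have hfin : ∀ R : ℕ → Prop, {N : ℕ | N ∈ Set.Icc 1 M ∧ R N}.Finite := fun R =>
    (Set.finite_Icc 1 M).subset fun N hN => hN.1
  have hIcc : (Set.Icc 1 M).ncard = M := by
    rw [← Finset.coe_Icc, Set.ncard_coe_finset, Nat.card_Icc, Nat.add_sub_cancel]
  have hup : Set.ncard {N : ℕ | N ∈ Set.Icc 1 M ∧ P N} ≤ M := by
    have := Set.ncard_le_ncard (fun N (hN : N ∈ {N : ℕ | N ∈ Set.Icc 1 M ∧ P N}) => hN.1)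
      (Set.finite_Icc 1 M)
    rwa [hIcc] at this
  -- Both `B` and the initial segment below `N₀` take at most `ε / 4 * M` elements.
  have hcover : Set.Icc 1 M ⊆ {N : ℕ | N ∈ Set.Icc 1 M ∧ P N} ∪
      ({N : ℕ | N ∈ Set.Icc 1 M ∧ B N} ∪ (Finset.range N₀ : Set ℕ)) := by
    intro N hN
    by_cases hlt : N < N₀
    · exact Or.inr (Or.inr (by simpa using hlt))
    · by_cases hNB : B N
      · exact Or.inr (Or.inl ⟨hN, hNB⟩)
      · exact Or.inl ⟨hN, hN₀ N (not_lt.1 hlt) hNB⟩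
  have hlow := Set.ncard_le_ncard hcover
    ((hfin P).union ((hfin B).union (Finset.finite_toSet _)))
  have hlow' : (M : ℝ) ≤ Set.ncard {N : ℕ | N ∈ Set.Icc 1 M ∧ P N} +
      (Set.ncard {N : ℕ | N ∈ Set.Icc 1 M ∧ B N} + N₀) := by
    have := hlow.trans ((Set.ncard_union_le _ _).trans
      (Nat.add_le_add_left (Set.ncard_union_le _ _) _))
    rw [hIcc, Set.ncard_coe_finset, Finset.card_range] at this
    exact_mod_cast this
  have hup' : (Set.ncard {N : ℕ | N ∈ Set.Icc 1 M ∧ P N} : ℝ) ≤ M := by exact_mod_cast hup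
  rw [Real.dist_eq, abs_lt]
  constructor
  · rw [lt_sub_iff_add_lt, lt_div_iff₀ hMpos]
    nlinarith
  · have := div_le_one_of_le₀ hup' hMpos.le
    linarith

theorem propositionA3 (α : ℝ) (hα : α ∈ Set.Ioo (1 : ℝ) 2) (r : ℕ) (hr : 1 ≤ r)
    (w : ℝ → ℝ) (hw_pos : ∀ x : ℝ, 1 ≤ x → 0 < w x)
    (hw_zero : Filter.Tendsto (fun x : ℝ => x ^ (α / 2 - 1) * w x) Filter.atTop (nhds 0))
    (hw_top : Filter.Tendsto w Filter.atTop Filter.atTop) :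
    -- the minimum defining `L_{α,3,r}(x)` exists for every `x ≥ 1`
    (∀ x : ℝ, 1 ≤ x → IsLeast (apLengthSet α 3 r x) (minLength α 3 r x)) ∧
    Filter.Tendsto
      (fun M : ℕ =>
        (({N : ℕ | N ∈ Set.Icc 1 M ∧
            minLength α 3 r (N : ℝ) ≤ (N : ℝ) ^ (1 - α / 2) * w (N : ℝ)}.ncard : ℕ) : ℝ) / (M : ℝ))
      Filter.atTop (nhds 1) := by

  have hleast : ∀ x : ℝ, IsLeast (apLengthSet α 3 r x) (minLength α 3 r x) := fun x =>
    isLeast_apLengthSet_minLength (exists_int_ge_isPolySeq hα hr x)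
  refine ⟨fun x _ => hleast x, tendsto_ncard_div_of_forall_eventually fun ε hε => ?_⟩
  obtain ⟨K, B, hgood, hcount⟩ := exists_eventually_card_filter_not_isPolySeq_le hα hr hε
  refine ⟨B, ?_, hcount⟩
  filter_upwards [hgood, Filter.eventually_ge_atTop 1,
    (hw_top.comp tendsto_natCast_atTop_atTop).eventually_ge_atTop (K : ℝ)] with N hN hN1 hwN hNB
  obtain ⟨m, hm, hAP⟩ := hN hNB
  have hN1' : (1 : ℝ) ≤ N := by exact_mod_cast hN1
  have hm' : (m : ℝ) ≤ K := by exact_mod_cast hm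
  have hmem : (m : ℝ) ∈ apLengthSet α 3 r N := by
    refine ⟨Nat.cast_nonneg m, ((N + m : ℕ) : ℤ), ?_, hAP⟩
    rw [Int.cast_natCast, Nat.cast_add]
    exact ⟨by linarith [(Nat.cast_nonneg m : (0 : ℝ) ≤ m)], le_rfl⟩
  have hpow : (1 : ℝ) ≤ (N : ℝ) ^ (1 - α / 2) := Real.one_le_rpow hN1' (by linarith [hα.2])
  calc minLength α 3 r N ≤ m := (hleast N).2 hmem
    _ ≤ w N := hm'.trans hwN
    _ ≤ (N : ℝ) ^ (1 - α / 2) * w N := le_mul_of_one_le_left (hw_pos N hN1').le hpow
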